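/- **Theorem 4.** Let $P(m,c)=\frac c2\{(m-2)c-(m-4)\}$ be the $c$-th $m$-gonal number. For integers $m>4$, $t\ge 1$, $n\ge 1$ let $r_{m,t}(n)$ be the number of representations $n=a+b$ (with $a\le b$ positive integers, i.e. disregarding the order of the summands) for which $ab=tP(m,c)$ for some integer $c$. For a discriminant $d<-4$ let $H(d)$ be the form class group, i.e. the group, under Gauss composition, of proper ($\mathrm{SL}_2(\mathbb Z)$-) equivalence classes of primitive positive definite integral binary quadratic forms of discriminant $d$, and for $K\in H(d)$ let $R(K,N)$ be the number of pairs $(x,y)\in\mathbb Z^2$ with $f(x,y)=N$, where $f$ is any form in $K$. If $H(d)$ is cyclic of order $4$ with identity $I$ and generator $A$, put, for $k=0,1,2,3$, $$F(A^k,N)=\frac12\sum_{s=0}^{3}\cos\frac{2\pi ks}{4}\,R(A^s,N);$$ thus $F(I,N)=\frac12\sum_{K\in H(d)}R(K,N)$, $F(A,N)=\frac12(R(I,N)-R(A^2,N))$ and $F(A^2,N)=\frac12(R(I,N)-R(A,N)+R(A^2,N)-R(A^3,N))$. (1) Let $(m,d)$ be one of $(9,-56)$, $(19,-136)$, $(25,-184)$,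 $(43,-328)$, $(73,-568)$, and let $t=1$. Then $d$ is a negative fundamental discriminant and $H(d)\cong\mathbb Z_4$. For every generator $A$ of $H(d)$ (with identity $I$) and every integer $n\ge1$, with $z=2(m-2)n^2+(m-4)^2$, $$r_{m,1}(n)=\begin{cases}\frac18\big(F(I,z)+2F(A,z)+F(A^2,z)\big)-1&\text{if } z \text{ is not a perfect square},\\[2pt] \frac18\big(F(I,z)+2F(A,z)+F(A^2,z)\big)-\frac12&\text{if } z \text{ is a perfect square}.\end{cases}$$ (2) Let $(m,d)$ be one of $(16,-56)$, $(36,-136)$, $(48,-184)$, $(84,-328)$, $(144,-568)$, and let $t=2$. Then $d$ is a negative fundamental discriminant and $H(d)\cong\mathbb Z_4$. For every generator $A$ of $H(d)$ (with identity $I$) and every integer $n\ge1$, with $z=\{(m-2)n^2+(m-4)^2\}/2$ (an integer), $$r_{m,2}(n)=\begin{cases}\frac18\big(F(I,z)-2F(A,z)+F(A^2,z)\big)-1&\text{if } 2z \text{ is not a perfect square},\\[2pt] \frac18\big(F(I,z)-2F(A,z)+F(A^2,z)\big)-\frac12&\text{if } 2z \text{ is a perfect square}.\end{cases}$$ -/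

import Mathlib

/-- A primitive, positive definite, integral binary quadratic form
`a x² + b x y + c y²` of discriminant `d`. -/
@[ext]
structure QForm (d : ℤ) where
  a : ℤ
  b : ℤ
  c : ℤ
  disc_eq : b ^ 2 - 4 * a * c = d
  primitive : ∀ k : ℤ, k ∣ a → k ∣ b → k ∣ c → IsUnit k
  posDef : ∀ x y : ℤ, (x ≠ 0 ∨ y ≠ 0) → 0 < a * x ^ 2 + b * x * y + c * y ^ 2

namespace QForm

/-- The value of the form at `(x, y)`. -/
def eval {d : ℤ} (f : QForm d) (x y : ℤ) : ℤ :=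
  f.a * x ^ 2 + f.b * x * y + f.c * y ^ 2

/-- Proper equivalence: `g` arises from `f` by a substitution in `SL₂(ℤ)`. -/
def ProperEquiv {d : ℤ} (f g : QForm d) : Prop :=
  ∃ p q r s : ℤ, p * s - q * r = 1 ∧
    ∀ x y : ℤ, g.eval x y = f.eval (p * x + q * y) (r * x + s * y)

theorem ProperEquiv.rfl' {d : ℤ} (f : QForm d) : ProperEquiv f f :=
  ⟨1, 0, 0, 1, by norm_num, fun x y => by simp⟩

theorem ProperEquiv.symm' {d : ℤ} {f g : QForm d} (h : ProperEquiv f g) :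
    ProperEquiv g f := by
  obtain ⟨p, q, r, s, hdet, h⟩ := h
  refine ⟨s, -q, -r, p, by linarith, fun x y => ?_⟩
  rw [h]
  have h1 : p * (s * x + -q * y) + q * (-r * x + p * y) = x := by
    linear_combination x * hdet
  have h2 : r * (s * x + -q * y) + s * (-r * x + p * y) = y := by
    linear_combination y * hdet
  rw [h1, h2]

theorem ProperEquiv.trans' {d : ℤ} {f g h : QForm d} (hfg : ProperEquiv f g)
    (hgh : ProperEquiv g h) : ProperEquiv f h := by
  obtain ⟨p, q, r, s, hdet, h1⟩ := hfg
  obtain ⟨p', q', r', s', hdet', h2⟩ := hgh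
  refine ⟨p * p' + q * r', p * q' + q * s', r * p' + s * r', r * q' + s * s', ?_, ?_⟩
  · linear_combination (p' * s' - q' * r') * hdet + hdet'
  · intro x y
    rw [h2, h1]
    congr 1 <;> ring

instance properSetoid (d : ℤ) : Setoid (QForm d) where
  r := ProperEquiv
  iseqv := ⟨ProperEquiv.rfl', ProperEquiv.symm', ProperEquiv.trans'⟩

/-- The number of pairs of integers `(x, y)` at which the form takes the value `n`. -/
noncomputable def rep {d : ℤ} (f : QForm d) (n : ℤ) : ℕ :=
  Set.ncard {v : ℤ × ℤ | f.eval v.1 v.2 = n}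

theorem rep_eq_of_properEquiv {d : ℤ} {f g : QForm d} (h : ProperEquiv f g) (n : ℤ) :
    f.rep n = g.rep n := by
  obtain ⟨p, q, r, s, hdet, h⟩ := h
  unfold rep
  symm
  refine Set.ncard_congr (fun v _ => (p * v.1 + q * v.2, r * v.1 + s * v.2)) ?_ ?_ ?_
  · intro v hv
    simpa [h] using hv
  · rintro ⟨x, y⟩ ⟨x', y'⟩ _ _ hv
    simp only [Prod.mk.injEq] at hv ⊢
    obtain ⟨h1, h2⟩ := hv
    constructor
    · linear_combination s * h1 - q * h2 - (x - x') * hdet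
    · linear_combination p * h2 - r * h1 - (y - y') * hdet
  · rintro ⟨x, y⟩ hv
    have h1 : p * (s * x - q * y) + q * (p * y - r * x) = x := by
      linear_combination x * hdet
    have h2 : r * (s * x - q * y) + s * (p * y - r * x) = y := by
      linear_combination y * hdet
    refine ⟨(s * x - q * y, p * y - r * x), ?_, ?_⟩
    · simp only [Set.mem_ofPred_eq] at hv ⊢
      rw [h, h1, h2]
      exact hv
    · simp only [h1, h2]

end QForm

/-- The set `H(d)` of proper equivalence classes of primitive, positive definite,
integral binary quadratic forms of discriminant `d`. -/
def FormClass (d : ℤ) : Type := Quotient (QForm.properSetoid d)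

namespace FormClass

/-- The class `[a, b, c]` of a form. -/
def mk {d : ℤ} (f : QForm d) : FormClass d := Quotient.mk _ f

/-- `R(K, n)`: the number of representations of `n` by (any form of) the class `K`. -/
noncomputable def R {d : ℤ} (K : FormClass d) (n : ℤ) : ℕ :=
  Quotient.lift (fun f : QForm d => f.rep n)
    (fun _ _ h => QForm.rep_eq_of_properEquiv h n) K

/-- Gauss composition of classes, through concordant forms (Dirichlet): `M` is the product of `K`
and `L` when there are forms `(a, b, a' c)` in `K`, `(a', b, a c)` in `L` and `(a a', b, c)`
in `M`. -/
def IsComp {d : ℤ} (K L M : FormClass d) : Prop :=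
  ∃ f g h : QForm d, mk f = K ∧ mk g = L ∧ mk h = M ∧
    f.b = h.b ∧ g.b = h.b ∧ h.a = f.a * g.a ∧ f.c = g.a * h.c ∧ g.c = f.a * h.c

/-- `e` is an isomorphism from the additive group `G` onto the form class group `H(d)`: it is a
bijection, and the classes that are products of `e x` and `e y` under Gauss composition are exactly
the one class `e (x + y)`. -/
def IsGroupIso {d : ℤ} {G : Type*} [AddGroup G] (e : G ≃ FormClass d) : Prop :=
  ∀ (x y : G) (M : FormClass d), IsComp (e x) (e y) M ↔ M = e (x + y)

/-- The number `ω(d)`. -/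
def omega (d : ℤ) : ℕ :=
  if 0 < d then 1 else if d = -4 then 4 else if d = -3 then 6 else 2

/-- The function `F(K, n)` on a cyclic form class group of order `h` with a generator `A`. The
generator is given through the isomorphism `e` with `e s = A ^ s`; the value is
`F(A ^ k, n) = (1 / ω(d)) ∑ₛ cos (2 π k s / h) R(A ^ s, n)`.
For `h = 4` this is `(R(I, n) - R(A², n)) / ω(d)` at `K = A`. -/
noncomputable def F {d : ℤ} {h : ℕ} [NeZero h] (e : ZMod h ≃ FormClass d) (K : FormClass d)
    (n : ℤ) : ℝ :=
  (1 / (omega d : ℝ)) * ∑ s : ZMod h,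
    Real.cos (2 * Real.pi * ((e.symm K).val : ℝ) * (s.val : ℝ) / (h : ℝ)) * (R (e s) n : ℝ)

end FormClass

/-- Fundamental discriminants. -/
def IsFundamentalDiscriminant (d : ℤ) : Prop :=
  (d ≠ 1 ∧ d % 4 = 1 ∧ Squarefree d) ∨
    ∃ k : ℤ, d = 4 * k ∧ (k % 4 = 2 ∨ k % 4 = 3) ∧ Squarefree k

/-- The `c`-th `m`-gonal number `P(m, c) = (c / 2) ((m - 2) c - (m - 4))`. -/
def polygonal (m : ℕ) (c : ℤ) : ℤ :=
  c * (((m : ℤ) - 2) * c - ((m : ℤ) - 4)) / 2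

/-- The division by `2` in `polygonal` is exact. -/
theorem two_mul_polygonal (m : ℕ) (c : ℤ) :
    2 * polygonal m c = c * (((m : ℤ) - 2) * c - ((m : ℤ) - 4)) := by
  unfold polygonal
  apply Int.mul_ediv_cancel'
  have h : (2 : ℤ) ∣ c * (c - 1) := (Int.even_mul_pred_self c).two_dvd
  obtain ⟨k, hk⟩ := h
  exact ⟨((m : ℤ) - 2) * k + c, by linear_combination ((m : ℤ) - 2) * hk⟩

/-- `r_{m,t}(n)`: the number of (unordered) representations `n = a + b` with positive integers
`a ≤ b` such that `a b = t P(m, c)`, where `c` is an integer, positive if `m ≤ 4`. -/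
noncomputable def repCount (m t n : ℕ) : ℕ :=
  Set.ncard {v : ℕ × ℕ | 0 < v.1 ∧ v.1 ≤ v.2 ∧ v.1 + v.2 = n ∧
    ∃ c : ℤ, (m ≤ 4 → 0 < c) ∧ (v.1 : ℤ) * (v.2 : ℤ) = (t : ℤ) * polygonal m c}

/-! Write d = -8p with p an odd prime. Expanding the cosines turns F(I) + 2F(A) + F(A²) into 2R(I,
z) and F(I) - 2F(A) + F(A²) into 2R(A², z). The claims therefore concern a single diagonal form
each: x² + 2py² for I and 2x² + py² for A².

Counting. For t = 1, where m = p + 2, x² + 2py² = z reads x² - (p-2)² = 2p(n² - y²). Since p is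
prime, the sign of x can be chosen so that x ≡ -(p-2) mod p; parity then gives x = 2pc - (p-2) and
n² - y² = 4P(m,c). So a = (n-y)/2 and b = (n+y)/2 satisfy ab = P(m,c). The case t = 2, where m = 2p
+ 2, is similar. Each value of |y| carries four points (±x, ±y), or two if y = 0; the value y = n,
which means a = 0, is the extra unit subtracted in the formulas (`ncard_diagonal`,
`ncard_sq_sub_sq`).

Class group. Writing p = a² - 2γ², the classes are those of x² + 2py², 2x² + py² and ax² ± 4γxy +
2ay². Reduction theory shows that there are no others, and explicit concordant forms give the
multiplication table of ℤ/4. That composition is single-valued and that the four classes differ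
comes from sending forms to ideals of ℤ[√-2p], up to scaling: properly equivalent forms give
equivalent ideals and composition becomes multiplication. It then suffices that (2, √-2p) is not
principal. -/

/-! ### Ideals up to scaling -/

/-- Two ideals of a ring are equivalent when they agree up to nonzero scalar factors. -/
def IdealEquiv {R : Type*} [CommRing R] (I J : Ideal R) : Prop :=
  ∃ α β : R, α ≠ 0 ∧ β ≠ 0 ∧ Ideal.span {α} * I = Ideal.span {β} * J

namespace IdealEquiv

variable {R : Type*} [CommRing R]

theorem refl [Nontrivial R] (I : Ideal R) : IdealEquiv I I :=
  ⟨1, 1, one_ne_zero, one_ne_zero, rfl⟩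

theorem of_eq [Nontrivial R] {I J : Ideal R} (h : I = J) : IdealEquiv I J := h ▸ refl I

theorem symm {I J : Ideal R} (h : IdealEquiv I J) : IdealEquiv J I := by
  obtain ⟨α, β, hα, hβ, h⟩ := h
  exact ⟨β, α, hβ, hα, h.symm⟩

theorem trans [NoZeroDivisors R] {I J K : Ideal R} (h : IdealEquiv I J) (h' : IdealEquiv J K) :
    IdealEquiv I K := by
  obtain ⟨α, β, hα, hβ, h⟩ := h
  obtain ⟨γ, δ, hγ, hδ, h'⟩ := h'
  refine ⟨γ * α, β * δ, mul_ne_zero hγ hα, mul_ne_zero hβ hδ, ?_⟩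
  simp only [← Ideal.span_singleton_mul_span_singleton]
  rw [mul_assoc, h, mul_left_comm, h', mul_assoc]

theorem mul [NoZeroDivisors R] {I I' J J' : Ideal R} (h : IdealEquiv I I')
    (h' : IdealEquiv J J') : IdealEquiv (I * J) (I' * J') := by
  obtain ⟨α, β, hα, hβ, h⟩ := h
  obtain ⟨γ, δ, hγ, hδ, h'⟩ := h'
  refine ⟨α * γ, β * δ, mul_ne_zero hα hγ, mul_ne_zero hβ hδ, ?_⟩
  simp only [← Ideal.span_singleton_mul_span_singleton]
  rw [mul_mul_mul_comm, h, h', mul_mul_mul_comm]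

end IdealEquiv

theorem Ideal.span_pair_eq_of_det_eq_one {R : Type*} [CommRing R] (u v p q r s : R)
    (h : p * s - q * r = 1) :
    Ideal.span {p * u + r * v, q * u + s * v} = Ideal.span {u, v} := by
  apply le_antisymm <;> rw [Ideal.span_le] <;> intro w hw <;>
    simp only [Set.mem_insert_iff, Set.mem_singleton_iff] at hw <;>
    rw [SetLike.mem_coe, Ideal.mem_span_pair] <;> rcases hw with rfl | rfl
  · exact ⟨p, r, rfl⟩
  · exact ⟨q, s, rfl⟩
  · exact ⟨s, -r, by linear_combination w * h⟩
  · exact ⟨-q, p, by linear_combination w * h⟩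

theorem Ideal.span_singleton_mul_span_pair {R : Type*} [CommRing R] (l u v : R) :
    Ideal.span {l} * Ideal.span {u, v} = Ideal.span {l * u, l * v} := by
  rw [Ideal.span_mul_span', Set.singleton_mul, Set.image_pair]

theorem Int.exists_bezout_three (a b c : ℤ) (h : ∀ k : ℤ, k ∣ a → k ∣ b → k ∣ c → IsUnit k) :
    ∃ u v w : ℤ, u * a + v * b + w * c = 1 := by
  have h1 := Int.gcd_eq_gcd_ab a b
  have h2 := Int.gcd_eq_gcd_ab (Int.gcd a b) c
  have hab : ((Int.gcd (Int.gcd a b) c : ℕ) : ℤ) ∣ Int.gcd a b := Int.gcd_dvd_left ..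
  have hu := h _ (hab.trans (Int.gcd_dvd_left ..)) (hab.trans (Int.gcd_dvd_right ..))
    (Int.gcd_dvd_right ..)
  have h3 : ((Int.gcd (Int.gcd a b) c : ℕ) : ℤ) = 1 := by
    rw [Int.isUnit_iff] at hu
    omega
  rw [h3] at h2
  refine ⟨Int.gcdA a b * Int.gcdA (Int.gcd a b) c, Int.gcdB a b * Int.gcdA (Int.gcd a b) c,
    Int.gcdB (Int.gcd a b) c, ?_⟩
  linear_combination -h2 - Int.gcdA (Int.gcd a b) c * h1

/-! ### Forms of discriminant -4N -/

/-- The discriminants `d = -4 N` with `N > 4` squarefree and `N ≡ 2 (mod 4)`. -/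
structure IsEvenDisc (d N : ℤ) : Prop where
  eq : d = -4 * N
  lt : 4 < N
  mod : N % 4 = 2
  sqf : Squarefree N

namespace IsEvenDisc

variable {d N : ℤ}

theorem noZeroDivisors (hd : IsEvenDisc d N) : NoZeroDivisors (ℤ√(-N)) where
  eq_zero_or_eq_zero_of_mul_eq_zero {x y} h := by
    have hN : -N < 0 := by linarith [hd.lt]
    rw [← Zsqrtd.norm_eq_zero_iff hN] at h ⊢
    rw [← Zsqrtd.norm_eq_zero_iff hN y]
    rw [Zsqrtd.norm_mul] at h
    exact mul_eq_zero.mp h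

theorem two_mul_half (hd : IsEvenDisc d N) (f : QForm d) : 2 * (f.b / 2) = f.b := by
  apply Int.mul_ediv_cancel'
  have h : Even (f.b ^ 2) := ⟨2 * (f.a * f.c - N), by
    linear_combination f.disc_eq + hd.eq⟩
  exact (Int.even_pow.mp h).1.two_dvd

theorem mul_sub_sq (hd : IsEvenDisc d N) (f : QForm d) : f.a * f.c - (f.b / 2) ^ 2 = N := by
  have h := hd.two_mul_half f
  have h1 := f.disc_eq.trans hd.eq
  rw [← h] at h1
  linarith

/-- The form `a x² + 2 b x y + c y²` with `a c - b² = N`. -/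
def form (hd : IsEvenDisc d N) (a b c : ℤ) (ha : 0 < a) (h : a * c - b ^ 2 = N) : QForm d where
  a := a
  b := 2 * b
  c := c
  disc_eq := by rw [hd.eq, ← h]; ring
  primitive k hka hkb hkc := by
    apply hd.sqf
    -- An even k would make a and c even, so N ≡ -b² mod 4, which is 0 or 3 but never 2.
    have hk : Odd k := by
      by_contra hk
      rw [Int.not_odd_iff_even] at hk
      obtain ⟨s, rfl⟩ := hka
      obtain ⟨t, rfl⟩ := hkc
      obtain ⟨j, rfl⟩ := hk.two_dvd
      have h4 := hd.mod
      have h5 : N = 4 * (j * s * j * t) - b ^ 2 := by rw [← h]; ring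
      rcases Int.even_or_odd' b with ⟨e, rfl | rfl⟩
      · have : N = 4 * (j * s * j * t - e ^ 2) := by rw [h5]; ring
        omega
      · have : N = 4 * (j * s * j * t - e ^ 2 - e) - 1 := by rw [h5]; ring
        omega
    have hkb' : k ∣ b := by
      refine IsCoprime.dvd_of_dvd_mul_left ?_ hkb
      obtain ⟨e, rfl⟩ := hk
      exact ⟨1, -e, by ring⟩
    rw [← h, sq]
    exact dvd_sub (mul_dvd_mul hka hkc) (mul_dvd_mul hkb' hkb')
  posDef x y hxy := by
    have hN := hd.lt
    refine pos_of_mul_pos_right (a := a) ?_ ha.le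
    have : a * (a * x ^ 2 + 2 * b * x * y + c * y ^ 2) = (a * x + b * y) ^ 2 + N * y ^ 2 := by
      rw [← h]; ring
    rw [this]
    rcases eq_or_ne y 0 with rfl | hy
    · have hx : x ≠ 0 := by simpa using hxy
      have := mul_pos (pow_pos ha 2) (pow_pos (abs_pos.mpr hx) 2)
      rw [sq_abs] at this
      nlinarith
    · have : 0 < y ^ 2 := by positivity
      nlinarith [sq_nonneg (a * x + b * y)]

end IsEvenDisc

/-! ### The ideal of a form -/

namespace QForm

variable {d : ℤ}

theorem a_pos (f : QForm d) : 0 < f.a := by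
  simpa using f.posDef 1 0 (by simp)

theorem properEquiv_iff {f g : QForm d} : FormClass.mk f = FormClass.mk g ↔ ProperEquiv f g :=
  Quotient.eq (r := properSetoid d)

/-- The ideal `(a, b / 2 + √(-N))` attached to a form of discriminant `-4 N`. -/
def ideal (N : ℤ) (f : QForm d) : Ideal (ℤ√(-N)) :=
  Ideal.span {(f.a : ℤ√(-N)), ⟨f.b / 2, 1⟩}

theorem ProperEquiv.idealEquiv {N : ℤ} (hd : IsEvenDisc d N) {f g : QForm d}
    (h : ProperEquiv f g) : IdealEquiv (f.ideal N) (g.ideal N) := by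
  obtain ⟨p, q, r, s, hdet, h⟩ := h
  have hf := hd.two_mul_half f
  have hg := hd.two_mul_half g
  have hN := hd.mul_sub_sq f
  have e1 := h 1 0
  have e2 := h 0 1
  have e3 := h 1 1
  simp only [eval] at e1 e2 e3
  unfold ideal
  generalize f.b / 2 = b at *
  generalize g.b / 2 = b' at *
  rw [← hf] at e1 e2 e3
  rw [← hg] at e1 e2 e3
  have ea : g.a = f.a * p ^ 2 + 2 * b * p * r + f.c * r ^ 2 := by linarith
  have eb : b' = f.a * p * q + f.c * r * s + b * (p * s + r * q) := by
    refine mul_left_cancel₀ (two_ne_zero (α := ℤ)) ?_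
    linear_combination e3 - e1 - e2
  have ha := f.a_pos
  have ha' := g.a_pos
  -- With θ = b + √-N and μ = pa + rθ, the first scalar is the conjugate of μ. It sends the new
  -- basis pa + rθ, qa + sθ to a·g.a and a·(b' + √-N), where a = f.a.
  refine ⟨⟨f.a * p + b * r, -r⟩, (f.a : ℤ√(-N)), ?_, by exact_mod_cast ha.ne', ?_⟩
  · intro h0
    rw [Zsqrtd.ext_iff] at h0
    simp only [Zsqrtd.re_zero, Zsqrtd.im_zero, neg_eq_zero] at h0
    obtain ⟨h1, rfl⟩ := h0
    rcases mul_eq_zero.mp (show f.a * p = 0 by linarith) with h2 | rfl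
    · exact ha.ne' h2
    · simp at hdet
  · rw [← Ideal.span_pair_eq_of_det_eq_one (f.a : ℤ√(-N)) ⟨b, 1⟩ p q r s (by exact_mod_cast hdet),
      Ideal.span_singleton_mul_span_pair, Ideal.span_singleton_mul_span_pair]
    congr 2
    · rw [Zsqrtd.ext_iff]
      constructor
      · simp
        rw [ea]
        linear_combination (-r ^ 2) * hN
      · simp
        ring
    · congr 1
      rw [Zsqrtd.ext_iff]
      constructor
      · simp
        rw [eb]
        linear_combination (-r * s) * hN
      · simp
        linear_combination f.a * hdet

/-- The product is generated by aa', aθ, a'θ and θ² = 2bθ - aa'c, so it lies in (aa', θ). Conversely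
a, a' and 2b are coprime, because f = (a, 2b, a'c) is primitive, and a Bézout relation recovers θ.
-/
theorem ideal_mul_of_concordant {N : ℤ} (hd : IsEvenDisc d N) {f g h : QForm d}
    (hf : f.b = h.b) (hg : g.b = h.b) (ha : h.a = f.a * g.a) (hc : f.c = g.a * h.c) :
    f.ideal N * g.ideal N = h.ideal N := by
  have h2 := hd.two_mul_half h
  have hN := hd.mul_sub_sq h
  obtain ⟨u, v, w, huv⟩ := Int.exists_bezout_three f.a g.a f.b fun k h1 h2 h3 =>
    f.primitive k h1 h3 (hc ▸ h2.mul_right _)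
  unfold ideal
  rw [hf, hg, Ideal.span_pair_mul_span_pair, ha]
  rw [hf, ← h2] at huv
  rw [ha] at hN
  generalize h.b / 2 = b at *
  have hsq : (⟨b, 1⟩ * ⟨b, 1⟩ : ℤ√(-N)) =
      ((2 * b : ℤ) : ℤ√(-N)) * ⟨b, 1⟩ - ((f.a * g.a : ℤ) : ℤ√(-N)) * (h.c : ℤ√(-N)) := by
    rw [Zsqrtd.ext_iff]
    constructor
    · simp
      linear_combination hN
    · simp
      ring
  have huv' : (u : ℤ√(-N)) * f.a + v * g.a + w * ((2 * b : ℤ) : ℤ√(-N)) = 1 := by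
    exact_mod_cast huv
  push_cast at hsq huv' ⊢
  generalize (⟨b, 1⟩ : ℤ√(-N)) = θ at *
  apply le_antisymm <;> rw [Ideal.span_le] <;> intro x hx <;>
    simp only [Set.mem_insert_iff, Set.mem_singleton_iff] at hx <;> rw [SetLike.mem_coe]
  · rw [Ideal.mem_span_pair]
    rcases hx with rfl | rfl | rfl | rfl
    · exact ⟨1, 0, by ring⟩
    · exact ⟨0, f.a, by ring⟩
    · exact ⟨0, g.a, by ring⟩
    · exact ⟨-h.c, 2 * b, by rw [hsq]; ring⟩
  · have m1 : ∀ y ∈ ({(f.a : ℤ√(-N)) * g.a, f.a * θ, θ * g.a, θ * θ} : Set (ℤ√(-N))),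
        y ∈ Ideal.span ({(f.a : ℤ√(-N)) * g.a, f.a * θ, θ * g.a, θ * θ} : Set (ℤ√(-N))) :=
      fun y hy => Ideal.subset_span hy
    simp only [Set.mem_insert_iff, Set.mem_singleton_iff, forall_eq_or_imp, forall_eq] at m1
    obtain ⟨n1, n2, n3, n4⟩ := m1
    rcases hx with rfl | rfl
    · exact n1
    · have : x = u * (f.a * x) + v * (x * g.a) + w * (x * x + h.c * (f.a * g.a)) := by
        rw [hsq]
        linear_combination (-x) * huv'
      have m := add_mem (add_mem (Ideal.mul_mem_left _ (u : ℤ√(-N)) n2)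
        (Ideal.mul_mem_left _ (v : ℤ√(-N)) n3))
        (Ideal.mul_mem_left _ (w : ℤ√(-N)) (add_mem n4 (Ideal.mul_mem_left _ (h.c : ℤ√(-N)) n1)))
      rwa [← this] at m

/-- If (2, √-N) = (γ), the norm of γ divides 4 and N. As N > 4, γ is a rational integer; it is even
because real parts in this ideal are even. Then 4 divides N, against N ≡ 2 mod 4. -/
theorem not_idealEquiv_of_eq_two {N : ℤ} (hd : IsEvenDisc d N) {f g : QForm d}
    (hfa : f.a = 2) (hfb : f.b = 0) (hg : g.a = 1) :
    ¬ IdealEquiv (f.ideal N) (g.ideal N) := by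
  rintro ⟨α, β, hα, hβ, h⟩
  have := hd.noZeroDivisors
  have hN := hd.lt
  have hmod := hd.mod
  have hg' : g.ideal N = ⊤ := by
    rw [Ideal.eq_top_iff_one]
    exact Ideal.subset_span (by simp [hg])
  rw [hg', Ideal.mul_top] at h
  have hβ' : β ∈ Ideal.span {α} * f.ideal N := h ▸ Ideal.mem_span_singleton_self β
  rw [Ideal.mem_span_singleton_mul] at hβ'
  obtain ⟨γ, hγ, rfl⟩ := hβ'
  have key : ∀ x ∈ f.ideal N, γ.norm ∣ x.norm := fun x hx => by
    have : α * x ∈ Ideal.span {α * γ} :=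
      h ▸ Ideal.mul_mem_mul (Ideal.mem_span_singleton_self α) hx
    rw [Ideal.mem_span_singleton] at this
    obtain ⟨δ, hδ⟩ := this
    rw [mul_assoc] at hδ
    rw [mul_left_cancel₀ hα hδ, Zsqrtd.norm_mul]
    exact dvd_mul_right _ _
  have k2 := key (2 : ℤ) (Ideal.subset_span (by simp [hfa]))
  have kN := key ⟨0, 1⟩ (Ideal.subset_span (by simp [hfb]))
  rw [ideal, Ideal.mem_span_pair] at hγ
  obtain ⟨s, t, hst⟩ := hγ
  have hre : γ.re = 2 * s.re - N * t.im := by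
    rw [← hst, hfa, hfb]
    simp
    ring
  simp only [Zsqrtd.norm_def] at k2 kN
  simp only [Zsqrtd.re_intCast, Zsqrtd.im_intCast] at k2 kN
  have hle := Int.le_of_dvd (by norm_num) k2
  have him : γ.im = 0 := by
    by_contra h0
    have : 0 < γ.im ^ 2 := by positivity
    nlinarith [sq_nonneg γ.re]
  rw [him] at kN
  obtain ⟨k, hk⟩ : (2 : ℤ) ∣ γ.re := by
    rw [hre]
    exact dvd_sub (dvd_mul_right _ _) (Dvd.dvd.mul_right (by omega) _)
  rw [hk] at kN
  obtain ⟨j, hj⟩ := kN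
  have : N = 4 * (k * k * j) := by linear_combination hj
  omega

end QForm

/-! ### Isomorphisms from ℤ/4 to the class group -/

namespace FormClass

variable {d : ℤ}

theorem mk_surjective : Function.Surjective (mk (d := d)) := Quotient.mk_surjective

theorem IsComp.symm {K L M : FormClass d} (h : IsComp K L M) : IsComp L K M := by
  obtain ⟨f, g, h, h1, h2, h3, h4, h5, h6, h7, h8⟩ := h
  exact ⟨g, f, h, h2, h1, h3, h5, h4, by rw [h6, mul_comm], h8, h7⟩

/-- The ideals attached to a product of form classes multiply accordingly. -/
theorem IsComp.idealEquiv {N : ℤ} (hd : IsEvenDisc d N) {f g h : QForm d}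
    (H : IsComp (mk f) (mk g) (mk h)) :
    IdealEquiv (f.ideal N * g.ideal N) (h.ideal N) := by
  have := hd.noZeroDivisors
  obtain ⟨f', g', h', h1, h2, h3, h4, h5, h6, h7, -⟩ := H
  have e := QForm.ideal_mul_of_concordant hd h4 h5 h6 h7
  have e1 := (QForm.properEquiv_iff.mp h1).idealEquiv hd
  have e2 := (QForm.properEquiv_iff.mp h2).idealEquiv hd
  have e3 := (QForm.properEquiv_iff.mp h3).idealEquiv hd
  exact ((e1.mul e2).symm.trans (.of_eq e)).trans e3

/-- A composition table modelled on `ZMod 4` that exhausts the classes is an isomorphism onto the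
form class group, as soon as the candidates for the classes of order two and one differ. -/
theorem exists_isGroupIso {N : ℤ} (hd : IsEvenDisc d N) (F : ZMod 4 → QForm d)
    (hsurj : ∀ f : QForm d, ∃ k, mk (F k) = mk f)
    (hcomp : ∀ x y, IsComp (mk (F x)) (mk (F y)) (mk (F (x + y))))
    (hne : ¬ IdealEquiv ((F 2).ideal N) ((F 0).ideal N)) :
    ∃ e : ZMod 4 ≃ FormClass d, IsGroupIso e ∧ ∀ x, e x = mk (F x) := by
  have := hd.noZeroDivisors
  have hmul : ∀ x y, IdealEquiv ((F x).ideal N * (F y).ideal N) ((F (x + y)).ideal N) :=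
    fun x y => (hcomp x y).idealEquiv hd
  have hsub : ∀ x y z, IdealEquiv ((F x).ideal N) ((F y).ideal N) →
      IdealEquiv ((F (x + z)).ideal N) ((F (y + z)).ideal N) := fun x y z h =>
    ((hmul x z).symm.trans (h.mul (.refl _))).trans (hmul y z)
  have hzero : ∀ x, IdealEquiv ((F x).ideal N) ((F 0).ideal N) → x = 0 := by
    intro x h
    have h' := (hsub x 0 x h).trans ((zero_add x).symm ▸ h)
    -- Every nontrivial subgroup of ℤ/4 contains 2, so the one inequivalence `hne` forces
    -- injectivity.
    have hx : x = 0 ∨ x = 2 ∨ x + x = 2 := by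
      clear h h'
      revert x
      decide
    rcases hx with hx | hx | hx
    · exact hx
    · exact absurd (hx ▸ h) hne
    · exact absurd (hx ▸ h') hne
  have hinj : ∀ x y, IdealEquiv ((F x).ideal N) ((F y).ideal N) → x = y := by
    intro x y h
    have := hsub x y (-y) h
    rw [add_neg_cancel] at this
    exact add_neg_eq_zero.mp (hzero _ this)
  refine ⟨Equiv.ofBijective (fun x => mk (F x)) ⟨fun x y h => ?_, fun K => ?_⟩, ?_, fun x => rfl⟩
  · exact hinj x y ((QForm.properEquiv_iff.mp h).idealEquiv hd)
  · obtain ⟨f, rfl⟩ := mk_surjective K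
    exact hsurj f
  · intro x y M
    change IsComp (mk (F x)) (mk (F y)) M ↔ M = mk (F (x + y))
    refine ⟨fun h => ?_, fun h => h ▸ hcomp x y⟩
    obtain ⟨f, rfl⟩ := mk_surjective M
    obtain ⟨k, hk⟩ := hsurj f
    rw [← hk] at h ⊢
    rw [hinj k (x + y) ((h.idealEquiv hd).symm.trans (hmul x y))]

/-- Any two isomorphisms from `ZMod 4` onto the form class group agree at `0` and at `2`. -/
theorem IsGroupIso.eq_zero_and_two {e e' : ZMod 4 ≃ FormClass d} (he : IsGroupIso e)
    (he' : IsGroupIso e') : e 0 = e' 0 ∧ e 2 = e' 2 := by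
  have hadd : ∀ x y, e'.symm (e (x + y)) = e'.symm (e x) + e'.symm (e y) := by
    intro x y
    have h := (he x y (e (x + y))).mpr rfl
    rw [← e'.apply_symm_apply (e x), ← e'.apply_symm_apply (e y)] at h
    rw [(he' _ _ _).mp h, e'.symm_apply_apply]
  have h0 := hadd 0 0
  have h2 := hadd 1 1
  have hne : e'.symm (e 2) ≠ e'.symm (e 0) := fun h =>
    absurd (e.injective (e'.symm.injective h)) (by decide)
  have e1 : (1 + 1 : ZMod 4) = 2 := rfl
  rw [e1] at h2
  rw [add_zero] at h0
  -- An automorphism of ℤ/4 fixes 0, the only idempotent, and 2, the only nonzero double.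
  have key : ∀ u w : ZMod 4, u = u + u → w + w ≠ u → u = 0 ∧ w + w = 2 := by decide
  rw [h2] at hne
  obtain ⟨k0, k2⟩ := key _ _ h0 hne
  rw [← h2] at k2
  rw [Equiv.symm_apply_eq] at k0 k2
  exact ⟨k0, k2⟩

end FormClass

/-! ### Reduction of forms -/

namespace IsEvenDisc

variable {d N : ℤ}

theorem properEquiv_of_dvd (hd : IsEvenDisc d N) {f g : QForm d} (ha : f.a = g.a)
    (hb : f.a ∣ g.b / 2 - f.b / 2) : QForm.ProperEquiv f g := by
  obtain ⟨k, hk⟩ := hb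
  have h1 := hd.two_mul_half f
  have h2 := hd.two_mul_half g
  have hb : g.b = f.b + 2 * f.a * k := by linear_combination 2 * hk - h2 + h1
  have hc : g.c = f.a * k ^ 2 + f.b * k + f.c := by
    refine mul_left_cancel₀ (mul_ne_zero four_ne_zero f.a_pos.ne') ?_
    have h3 := f.disc_eq
    have h4 := g.disc_eq
    rw [hb, ← ha] at h4
    linear_combination h3 - h4
  refine ⟨1, k, 0, 1, by ring, fun x y => ?_⟩
  simp only [QForm.eval, ← ha, hb, hc]
  ring

theorem properEquiv_of_swap {f g : QForm d} (ha : g.a = f.c)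
    (hb : g.b = -f.b) : QForm.ProperEquiv f g := by
  have hc : g.c = f.a := by
    refine mul_left_cancel₀ (mul_ne_zero four_ne_zero g.a_pos.ne') ?_
    have h3 := f.disc_eq
    have h4 := g.disc_eq
    rw [hb] at h4
    linear_combination h3 - h4 - 4 * f.a * ha
  refine ⟨0, -1, 1, 0, by ring, fun x y => ?_⟩
  simp only [QForm.eval, ha, hb, hc]
  ring

/-- Take the least leading coefficient in the class and translate to centre the middle one. Swapping
the variables makes c a leading coefficient of the class, so a ≤ c by minimality. -/
theorem exists_reduced (hd : IsEvenDisc d N) (f : QForm d) :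
    ∃ g : QForm d, QForm.ProperEquiv f g ∧ 2 * |g.b / 2| ≤ g.a ∧ g.a ≤ g.c := by
  classical
  have hex : ∃ n : ℕ, ∃ g : QForm d, QForm.ProperEquiv f g ∧ g.a = n :=
    ⟨f.a.toNat, f, .rfl' f, by rw [Int.toNat_of_nonneg f.a_pos.le]⟩
  obtain ⟨g, hfg, hga⟩ := Nat.find_spec hex
  have hmin : ∀ h : QForm d, QForm.ProperEquiv f h → g.a ≤ h.a := fun h hh => by
    have := Nat.find_min' hex ⟨h, hh, (Int.toNat_of_nonneg h.a_pos.le).symm⟩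
    have h0 := h.a_pos
    omega
  have hpos := g.a_pos
  obtain ⟨b, hb, hdvd⟩ : ∃ b : ℤ, 2 * |b| ≤ g.a ∧ g.a ∣ b - g.b / 2 := by
    have h1 := Int.emod_nonneg (g.b / 2) hpos.ne'
    have h2 := Int.emod_lt_of_pos (g.b / 2) hpos
    have h3 := Int.emod_add_mul_ediv (g.b / 2) g.a
    by_cases h : 2 * (g.b / 2 % g.a) ≤ g.a
    · exact ⟨g.b / 2 % g.a, by rwa [abs_of_nonneg h1], -(g.b / 2 / g.a),
        by linear_combination h3⟩
    · refine ⟨g.b / 2 % g.a - g.a, ?_, -(g.b / 2 / g.a) - 1, by linear_combination h3⟩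
      rw [abs_of_neg (by linarith)]
      linarith
  have hN := hd.mul_sub_sq g
  obtain ⟨c, hc⟩ : g.a ∣ b ^ 2 + N := by
    have : b ^ 2 + N = (b - g.b / 2) * (b + g.b / 2) + g.a * g.c := by linear_combination -hN
    rw [this]
    exact dvd_add (hdvd.mul_right _) (dvd_mul_right _ _)
  have hN' : g.a * c - b ^ 2 = N := by linear_combination -hc
  have hgh : QForm.ProperEquiv g (hd.form g.a b c hpos hN') :=
    hd.properEquiv_of_dvd rfl (by simpa [form] using hdvd)
  refine ⟨hd.form g.a b c hpos hN', hfg.trans' hgh, by simpa [form] using hb, ?_⟩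
  have hcpos : 0 < c := by
    have := hd.lt
    refine pos_of_mul_pos_right (a := g.a) ?_ hpos.le
    nlinarith [sq_nonneg b]
  exact hmin (hd.form c (-b) g.a hcpos (by rw [← hN']; ring)) ((hfg.trans' hgh).trans'
    (properEquiv_of_swap rfl (by simp [form])))

end IsEvenDisc

/-! ### The explicit composition table -/

namespace FormClass

open QForm (properEquiv_iff)

variable {d N : ℤ}

theorem isComp_one (hd : IsEvenDisc d N) (h : 1 * N - 0 ^ 2 = N) (f : QForm d) :
    IsComp (mk (hd.form 1 0 N one_pos h)) (mk f) (mk f) := by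
  have hN := hd.mul_sub_sq f
  refine ⟨hd.form 1 (f.b / 2) (f.a * f.c) one_pos (by rw [one_mul]; exact hN), f, f, ?_, rfl, rfl,
    ?_, rfl, ?_, rfl, ?_⟩
  · exact properEquiv_iff.mpr (hd.properEquiv_of_dvd rfl (one_dvd _))
  · exact hd.two_mul_half f
  · exact (one_mul _).symm
  · exact (one_mul _).symm

variable {a γ p : ℤ}

theorem isComp_two_two (hd : IsEvenDisc d (2 * p)) (hp : 0 < p) (h : 2 * p - 0 ^ 2 = 2 * p)
    (h' : 1 * (2 * p) - 0 ^ 2 = 2 * p) :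
    IsComp (mk (hd.form 2 0 p two_pos h)) (mk (hd.form 2 0 p two_pos h))
      (mk (hd.form 1 0 (2 * p) one_pos h')) := by
  refine ⟨hd.form 2 0 p two_pos h, hd.form p 0 2 hp (by ring),
    hd.form (2 * p) 0 1 (by positivity) (by ring), rfl, ?_, ?_, rfl, rfl, rfl, ?_, ?_⟩
  · exact properEquiv_iff.mpr (IsEvenDisc.properEquiv_of_swap rfl (by simp [IsEvenDisc.form]))
  · exact properEquiv_iff.mpr (IsEvenDisc.properEquiv_of_swap rfl (by simp [IsEvenDisc.form]))
  · simp [IsEvenDisc.form]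
  · simp [IsEvenDisc.form]

/-- The last coefficient 2a is divisible by a, so (a, 4γ, 2a) is concordant with itself. The product
(a², 4γ, 2) becomes (2, 0, p) after a swap and a translation. -/
theorem isComp_square (hd : IsEvenDisc d (2 * p)) (ha : 0 < a)
    (h : a * (2 * a) - (2 * γ) ^ 2 = 2 * p) (h' : 2 * p - 0 ^ 2 = 2 * p) :
    IsComp (mk (hd.form a (2 * γ) (2 * a) ha h)) (mk (hd.form a (2 * γ) (2 * a) ha h))
      (mk (hd.form 2 0 p two_pos h')) := by
  have h1 : a * a * 2 - (2 * γ) ^ 2 = 2 * p := by rw [← h]; ring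
  have h2 : 2 * (a * a) - (-(2 * γ)) ^ 2 = 2 * p := by rw [← h]; ring
  refine ⟨_, _, hd.form (a * a) (2 * γ) 2 (mul_pos ha ha) h1, rfl, rfl, ?_, rfl, rfl, rfl, ?_, ?_⟩
  · refine (properEquiv_iff.mpr
      (IsEvenDisc.properEquiv_of_swap (g := hd.form 2 (-(2 * γ)) (a * a) two_pos h2) rfl ?_)).trans
      (properEquiv_iff.mpr (hd.properEquiv_of_dvd rfl ?_))
    · simp [IsEvenDisc.form]
    · simp only [IsEvenDisc.form, Int.mul_ediv_cancel_left _ (two_ne_zero (α := ℤ))]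
      exact ⟨γ, by ring⟩
  · simp [IsEvenDisc.form, mul_comm]
  · simp [IsEvenDisc.form, mul_comm]

/-- A translation turns (2, 0, p) into (2, 4γ, a²), concordant with (a, 4γ, 2a); the product (2a,
4γ, a) is a swap of (a, -4γ, 2a). -/
theorem isComp_mul_two (hd : IsEvenDisc d (2 * p)) (ha : 0 < a)
    (h : a * (2 * a) - (2 * γ) ^ 2 = 2 * p) (h' : a * (2 * a) - (2 * -γ) ^ 2 = 2 * p)
    (h'' : 2 * p - 0 ^ 2 = 2 * p) :
    IsComp (mk (hd.form a (2 * γ) (2 * a) ha h)) (mk (hd.form 2 0 p two_pos h''))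
      (mk (hd.form a (2 * -γ) (2 * a) ha h')) := by
  refine ⟨_, hd.form 2 (2 * γ) (a * a) two_pos (by rw [← h]; ring),
    hd.form (a * 2) (2 * γ) a (by positivity) (by rw [← h]; ring), rfl, ?_, ?_,
    rfl, rfl, rfl, rfl, rfl⟩
  · exact properEquiv_iff.mpr (hd.properEquiv_of_dvd rfl (by simp [IsEvenDisc.form]))
  · exact properEquiv_iff.mpr (IsEvenDisc.properEquiv_of_swap rfl (by simp [IsEvenDisc.form]))

/-- A swap turns (a, -4γ, 2a) into (2a, 4γ, a), and the product (2a², 4γ, 1) represents 1. -/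
theorem isComp_inv (hd : IsEvenDisc d (2 * p)) (ha : 0 < a)
    (h : a * (2 * a) - (2 * γ) ^ 2 = 2 * p) (h' : a * (2 * a) - (2 * -γ) ^ 2 = 2 * p)
    (h'' : 1 * (2 * p) - 0 ^ 2 = 2 * p) :
    IsComp (mk (hd.form a (2 * γ) (2 * a) ha h)) (mk (hd.form a (2 * -γ) (2 * a) ha h'))
      (mk (hd.form 1 0 (2 * p) one_pos h'')) := by
  have h1 : 2 * a * a - (2 * γ) ^ 2 = 2 * p := by rw [← h]; ring
  have h2 : a * (2 * a) * 1 - (2 * γ) ^ 2 = 2 * p := by rw [← h]; ring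
  have h3 : 1 * (a * (2 * a)) - (-(2 * γ)) ^ 2 = 2 * p := by rw [← h]; ring
  refine ⟨_, hd.form (2 * a) (2 * γ) a (by positivity) h1,
    hd.form (a * (2 * a)) (2 * γ) 1 (by positivity) h2, rfl, ?_, ?_, rfl, rfl, rfl, ?_, ?_⟩
  · exact properEquiv_iff.mpr (IsEvenDisc.properEquiv_of_swap rfl (by simp [IsEvenDisc.form]))
  · exact (properEquiv_iff.mpr
      (IsEvenDisc.properEquiv_of_swap (g := hd.form 1 (-(2 * γ)) (a * (2 * a)) one_pos h3) rfl
        (by simp [IsEvenDisc.form]))).trans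
      (properEquiv_iff.mpr (hd.properEquiv_of_dvd rfl (one_dvd _)))
  · exact (mul_one _).symm
  · exact (mul_one _).symm

/-- A discriminant `-8 (a² - 2 γ²)` whose reduced forms are equivalent to `x² + 2 p y²`,
`2 x² + p y²` and `a x² ± 4 γ x y + 2 a y²` has a cyclic form class group of order four. -/
theorem exists_isGroupIso_of_reduced (hd : IsEvenDisc d (2 * p)) (ha : 0 < a) (hp : 0 < p)
    (h : a * (2 * a) - (2 * γ) ^ 2 = 2 * p)
    (hred : ∀ a' b c : ℤ, a' * c - b ^ 2 = 2 * p → 2 * |b| ≤ a' → a' ≤ c →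
      (a' = 1 ∨ a' = 2 ∧ 2 ∣ b) ∨ a' = a ∧ (a ∣ b - 2 * γ ∨ a ∣ b + 2 * γ)) :
    ∃ e : ZMod 4 ≃ FormClass d, IsGroupIso e ∧
      (∃ f : QForm d, e 0 = mk f ∧ f.a = 1 ∧ f.b = 0 ∧ f.c = 2 * p) ∧
      ∃ f : QForm d, e 2 = mk f ∧ f.a = 2 ∧ f.b = 0 ∧ f.c = p := by
  have h0 : 1 * (2 * p) - 0 ^ 2 = 2 * p := by ring
  have h2 : 2 * p - 0 ^ 2 = 2 * p := by ring
  have h3 : a * (2 * a) - (2 * -γ) ^ 2 = 2 * p := by rw [← h]; ring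
  have h1 : a * (2 * a) - (2 * - -γ) ^ 2 = 2 * p := by rw [← h]; ring
  have c11 := isComp_square hd ha h h2
  have c12 := isComp_mul_two hd ha h h3 h2
  have c13 := isComp_inv hd ha h h3 h0
  have c22 := isComp_two_two hd hp h2 h0
  have c33 := isComp_square hd ha h3 h2
  have c32 := isComp_mul_two hd ha h3 h1 h2
  simp only [neg_neg] at c32
  have c0 := isComp_one hd h0
  set F0 := hd.form 1 0 (2 * p) one_pos h0 with hF0
  set F1 := hd.form a (2 * γ) (2 * a) ha h with hF1
  set F2 := hd.form 2 0 p two_pos h2 with hF2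
  set F3 := hd.form a (2 * -γ) (2 * a) ha h3 with hF3
  let F : ZMod 4 → QForm d := (![F0, F1, F2, F3] : Fin 4 → QForm d)
  have hsurj : ∀ f : QForm d, ∃ k, mk (F k) = mk f := by
    intro f
    obtain ⟨g, hfg, hb, hc⟩ := hd.exists_reduced f
    rw [properEquiv_iff.mpr hfg]
    rcases hred g.a (g.b / 2) g.c (hd.mul_sub_sq g) hb hc with (h4 | ⟨h4, h5⟩) | ⟨h4, h5 | h5⟩
    · exact ⟨0, properEquiv_iff.mpr (hd.properEquiv_of_dvd h4.symm (one_dvd _))⟩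
    · refine ⟨2, properEquiv_iff.mpr (hd.properEquiv_of_dvd h4.symm ?_)⟩
      change 2 ∣ g.b / 2 - 2 * 0 / 2
      simpa using h5
    · refine ⟨1, properEquiv_iff.mpr (hd.properEquiv_of_dvd h4.symm ?_)⟩
      change a ∣ g.b / 2 - 2 * (2 * γ) / 2
      rwa [Int.mul_ediv_cancel_left _ two_ne_zero]
    · refine ⟨3, properEquiv_iff.mpr (hd.properEquiv_of_dvd h4.symm ?_)⟩
      change a ∣ g.b / 2 - 2 * (2 * -γ) / 2
      rwa [Int.mul_ediv_cancel_left _ two_ne_zero, mul_neg, sub_neg_eq_add]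
  have hcomp : ∀ x y, IsComp (mk (F x)) (mk (F y)) (mk (F (x + y))) := by
    intro x y
    fin_cases x <;> fin_cases y
    · exact c0 F0
    · exact c0 F1
    · exact c0 F2
    · exact c0 F3
    · exact (c0 F1).symm
    · exact c11
    · exact c12
    · exact c13
    · exact (c0 F2).symm
    · exact c12.symm
    · exact c22
    · exact c32.symm
    · exact (c0 F3).symm
    · exact c13.symm
    · exact c32
    · exact c33
  obtain ⟨e, he, hF⟩ := exists_isGroupIso hd F hsurj hcomp
    (QForm.not_idealEquiv_of_eq_two (f := F2) (g := F0) hd rfl (by simp [F2, IsEvenDisc.form]) rfl)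
  exact ⟨e, he, ⟨F0, hF 0, rfl, by simp [hF0, IsEvenDisc.form], rfl⟩,
    ⟨F2, hF 2, rfl, by simp [hF2, IsEvenDisc.form], rfl⟩⟩

end FormClass

/-! ### Counting points and polygonal numbers -/

theorem polygonal_nonneg {m : ℕ} (hm : 4 < m) (c : ℤ) : 0 ≤ polygonal m c := by
  have h := two_mul_polygonal m c
  have hm' : (4 : ℤ) < m := by exact_mod_cast hm
  suffices 0 ≤ c * (((m : ℤ) - 2) * c - ((m : ℤ) - 4)) by linarith
  rcases le_or_gt c 0 with hc | hc
  · exact mul_nonneg_of_nonpos_of_nonpos hc (by nlinarith)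
  · exact mul_nonneg hc.le (by nlinarith)

theorem polygonal_eq_zero {m : ℕ} (hm : 4 < m) {c : ℤ} : polygonal m c = 0 ↔ c = 0 := by
  have h := two_mul_polygonal m c
  have hm' : (4 : ℤ) < m := by exact_mod_cast hm
  refine ⟨fun h0 => ?_, fun h0 => by simpa [h0] using h⟩
  rw [h0, mul_zero, eq_comm, mul_eq_zero] at h
  rcases h with h | h
  · exact h
  · rcases le_or_gt c 0 with hc | hc <;> nlinarith

/-- The integer points of `α x² + γ y² = z`, none of which has `x = 0`, counted by their
values of `|y|`. -/
theorem ncard_diagonal {α γ z : ℤ} (hα : 0 < α) (hγ : 0 < γ) (hx : ∀ y : ℤ, γ * y ^ 2 ≠ z) :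
    {v : ℤ × ℤ | α * v.1 ^ 2 + γ * v.2 ^ 2 = z}.ncard +
      {y : ℕ | y = 0 ∧ ∃ x : ℤ, α * x ^ 2 + γ * (y : ℤ) ^ 2 = z}.ncard * 2 =
      4 * {y : ℕ | ∃ x : ℤ, α * x ^ 2 + γ * (y : ℤ) ^ 2 = z}.ncard := by
  classical
  have hfin : {y : ℕ | ∃ x : ℤ, α * x ^ 2 + γ * (y : ℤ) ^ 2 = z}.Finite := by
    refine (Set.finite_Iic z.toNat).subset ?_
    rintro y ⟨x, h⟩
    have h1 : (y : ℤ) ≤ z := by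
      have : (y : ℤ) ≤ (y : ℤ) ^ 2 := by exact_mod_cast Nat.le_self_pow two_ne_zero y
      nlinarith [mul_nonneg hα.le (sq_nonneg x), sq_nonneg (y : ℤ)]
    rw [Set.mem_Iic]
    omega
  obtain ⟨Y, hY⟩ := hfin.exists_finset
  have hx' : ∀ y : ℕ, ∃ x : ℤ, y ∈ Y → α * x ^ 2 + γ * (y : ℤ) ^ 2 = z := fun y => by
    by_cases h : y ∈ Y
    · obtain ⟨x, h'⟩ := (hY y).mp h
      exact ⟨x, fun _ => h'⟩
    · exact ⟨0, fun h' => absurd h' h⟩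
  choose x hxy using hx'
  have hY' : {y : ℕ | ∃ x : ℤ, α * x ^ 2 + γ * (y : ℤ) ^ 2 = z} = Y := by
    ext y
    exact (hY y).symm
  have hY0 : {y : ℕ | y = 0 ∧ ∃ x : ℤ, α * x ^ 2 + γ * (y : ℤ) ^ 2 = z} =
      (Y.filter (· = 0) : Finset ℕ) := by
    ext y
    rw [Finset.coe_filter]
    exact ⟨fun h => ⟨(hY y).mpr h.2, h.1⟩, fun h => ⟨h.2, (hY y).mp h.1⟩⟩
  have hS : {v : ℤ × ℤ | α * v.1 ^ 2 + γ * v.2 ^ 2 = z} =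
      (Y.biUnion fun y => ({x y, -x y} : Finset ℤ) ×ˢ {(y : ℤ), -(y : ℤ)} : Finset (ℤ × ℤ)) := by
    ext ⟨u, v⟩
    simp only [Set.mem_ofPred_eq, Finset.coe_biUnion, Set.mem_iUnion, Finset.mem_coe,
      Finset.mem_product, Finset.mem_insert, Finset.mem_singleton, exists_prop]
    constructor
    · intro h
      have hv : v.natAbs ∈ Y := (hY _).mpr ⟨u, by rw [Int.natCast_natAbs, sq_abs]; exact h⟩
      refine ⟨v.natAbs, hv, ?_, by omega⟩
      have h1 := hxy _ hv
      rw [Int.natCast_natAbs, sq_abs] at h1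
      exact sq_eq_sq_iff_eq_or_eq_neg.mp (mul_left_cancel₀ hα.ne' (by linarith))
    · rintro ⟨y, hy, h1, h2⟩
      rw [← hxy y hy, sq_eq_sq_iff_eq_or_eq_neg.mpr h1, sq_eq_sq_iff_eq_or_eq_neg.mpr h2]
  rw [hS, hY0, hY', Set.ncard_coe_finset, Set.ncard_coe_finset, Set.ncard_coe_finset,
    Finset.card_biUnion, Finset.card_filter, Finset.sum_mul, ← Finset.sum_add_distrib, mul_comm,
    Finset.card_eq_sum_ones, Finset.sum_mul]
  -- Each fibre has four points, or two if y = 0, where the correction term adds the missing two;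
  -- `hx` rules out x = 0.
  · refine Finset.sum_congr rfl fun y hy => ?_
    have hx0 : x y ≠ -x y := fun h => by
      have : x y = 0 := by omega
      apply hx y
      simpa [this] using hxy y hy
    rw [Finset.card_product, Finset.card_pair hx0]
    by_cases h0 : y = 0
    · simp [h0]
    · rw [Finset.card_pair (by omega)]
      simp [h0]
  · intro y _ y' _ hne
    rw [Function.onFun, Finset.disjoint_left]
    rintro ⟨u, v⟩ h1 h2
    simp only [Finset.mem_product, Finset.mem_insert, Finset.mem_singleton] at h1 h2
    omega

/-- The representations counted by `repCount` correspond to the values of `b - a`; the value `n`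
belongs to the excluded `a = 0`. -/
theorem ncard_sq_sub_sq {m t n : ℕ} (hm : 4 < m) (ht : 0 < t) (hn : 0 < n) :
    {y : ℕ | ∃ c : ℤ, (n : ℤ) ^ 2 - (y : ℤ) ^ 2 = 4 * t * polygonal m c}.ncard =
      repCount m t n + 1 := by
  unfold repCount
  set T := {v : ℕ × ℕ | 0 < v.1 ∧ v.1 ≤ v.2 ∧ v.1 + v.2 = n ∧
    ∃ c : ℤ, (m ≤ 4 → 0 < c) ∧ (v.1 : ℤ) * (v.2 : ℤ) = (t : ℤ) * polygonal m c} with hT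
  have hTfin : T.Finite := by
    refine (Set.finite_Iic (n, n)).subset ?_
    rintro ⟨a, b⟩ ⟨-, -, h, -⟩
    simp only at h
    rw [Set.mem_Iic, Prod.mk_le_mk]
    omega
  have hinj : Set.InjOn (fun v : ℕ × ℕ => v.2 - v.1) T := by
    rintro ⟨a, b⟩ ⟨-, h1, h2, -⟩ ⟨a', b'⟩ ⟨-, h1', h2', -⟩ h
    simp only at h h1 h2 h1' h2'
    rw [Prod.mk.injEq]
    omega
  rw [← hinj.ncard_image, ← Set.ncard_insert_of_notMem (a := n) _ (hTfin.image _)]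
  · congr 1
    ext y
    simp only [Set.mem_ofPred_eq, Set.mem_insert_iff, Set.mem_image, Prod.exists]
    constructor
    · rintro ⟨c, hc⟩
      rcases eq_or_ne y n with h | hne
      · exact .inl h
      right
      have hle : y ≤ n := by
        have h1 : (y : ℤ) ^ 2 ≤ (n : ℤ) ^ 2 := by
          have := mul_nonneg (show (0 : ℤ) ≤ 4 * t by positivity) (polygonal_nonneg hm c)
          linarith
        exact_mod_cast (sq_le_sq₀ (by positivity) (by positivity)).mp h1
      obtain ⟨k, rfl⟩ := Nat.exists_eq_add_of_le hle
      push_cast at hc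
      -- Here k = n - y = b - a - y + 2a with y = b - a, so a = k/2. For odd k, n² - y² = k(k + 2y)
      -- is odd and cannot be a multiple of 4.
      rcases Nat.even_or_odd' k with ⟨j, rfl | rfl⟩
      · push_cast at hc
        refine ⟨j, j + y, ⟨by omega, by omega, by ring, c, by omega, ?_⟩, by omega⟩
        push_cast
        linarith
      · push_cast at hc
        have : 2 * (2 * ((j : ℤ) * j) + 2 * j + 2 * (j * y) + y - 2 * (t * polygonal m c)) =
          -1 := by linarith
        omega
    · rintro (rfl | ⟨a, b, ⟨-, h2, h3, c, -, h4⟩, h5⟩)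
      · exact ⟨0, by simp [(polygonal_eq_zero hm).mpr rfl]⟩
      · refine ⟨c, ?_⟩
        simp only at h2 h3 h4
        obtain ⟨k, rfl⟩ := Nat.exists_eq_add_of_le h2
        have hy : y = k := by omega
        rw [mul_assoc, ← h4, ← h3, hy]
        push_cast
        ring
  · rintro ⟨⟨a, b⟩, ⟨h1, h2, h3, -⟩, h⟩
    simp only at h h1 h2 h3
    omega

/-- The count of representations by a diagonal form whose points are parametrised by polygonal
numbers. -/
theorem ncard_diagonal_eq_repCount {α γ z : ℤ} {m t n : ℕ} (hα : 0 < α) (hγ : 0 < γ) (hm : 4 < m)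
    (ht : 0 < t) (hn : 0 < n) (hx : ∀ y : ℤ, γ * y ^ 2 ≠ z)
    (hkey : ∀ y : ℤ, (∃ x : ℤ, α * x ^ 2 + γ * y ^ 2 = z) ↔
      ∃ c : ℤ, (n : ℤ) ^ 2 - y ^ 2 = 4 * t * polygonal m c) :
    ((¬ ∃ x : ℤ, α * x ^ 2 = z) → {v : ℤ × ℤ | α * v.1 ^ 2 + γ * v.2 ^ 2 = z}.ncard =
      4 * (repCount m t n + 1)) ∧
    ((∃ x : ℤ, α * x ^ 2 = z) → {v : ℤ × ℤ | α * v.1 ^ 2 + γ * v.2 ^ 2 = z}.ncard + 2 =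
      4 * (repCount m t n + 1)) := by
  have h1 := ncard_diagonal hα hγ hx
  have h2 := ncard_sq_sub_sq hm ht hn
  simp only [← hkey] at h2
  rw [h2] at h1
  constructor
  · intro h
    have h0 : {y : ℕ | y = 0 ∧ ∃ x : ℤ, α * x ^ 2 + γ * (y : ℤ) ^ 2 = z} = ∅ := by
      rw [Set.eq_empty_iff_forall_notMem]
      rintro y ⟨rfl, x, hxz⟩
      exact h ⟨x, by simpa using hxz⟩
    simpa [h0] using h1
  · rintro ⟨x, h⟩
    have h0 : {y : ℕ | y = 0 ∧ ∃ x : ℤ, α * x ^ 2 + γ * (y : ℤ) ^ 2 = z} = {0} := by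
      ext y
      refine ⟨fun h => h.1, ?_⟩
      rintro rfl
      exact ⟨rfl, x, by simpa using h⟩
    simpa [h0] using h1

/-! ### The functions F in terms of R -/

namespace FormClass

variable {d : ℤ}

theorem R_mk_of_diagonal (f : QForm d) (hb : f.b = 0) (z : ℤ) :
    R (mk f) z = {v : ℤ × ℤ | f.a * v.1 ^ 2 + f.c * v.2 ^ 2 = z}.ncard := by
  change f.rep z = _
  simp [QForm.rep, QForm.eval, hb]

theorem F_values (hd : d < -4) (e : ZMod 4 ≃ FormClass d) (z : ℤ) :
    F e (e 0) z = 1 / 2 * (R (e 0) z + R (e 1) z + R (e 2) z + R (e 3) z) ∧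
    F e (e 1) z = 1 / 2 * (R (e 0) z - R (e 2) z) ∧
    F e (e 2) z = 1 / 2 * (R (e 0) z - R (e 1) z + R (e 2) z - R (e 3) z) := by
  have hω : omega d = 2 := by
    unfold omega
    rw [if_neg (by omega), if_neg (by omega), if_neg (by omega)]
  have hsum : ∀ g : ZMod 4 → ℝ, ∑ s, g s = g 0 + g 1 + g 2 + g 3 := Fin.sum_univ_four
  have v0 : (0 : ZMod 4).val = 0 := rfl
  have v1 : (1 : ZMod 4).val = 1 := rfl
  have v2 : (2 : ZMod 4).val = 2 := rfl
  have v3 : (3 : ZMod 4).val = 3 := rfl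
  have c11 : Real.cos (2 * Real.pi * 1 * 1 / 4) = 0 := by
    rw [← Real.cos_pi_div_two]; congr 1; ring
  have c12 : Real.cos (2 * Real.pi * 1 * 2 / 4) = -1 := by
    rw [← Real.cos_pi]; congr 1; ring
  have c13 : Real.cos (2 * Real.pi * 1 * 3 / 4) = 0 := by
    rw [show 2 * Real.pi * 1 * 3 / 4 = Real.pi / 2 + Real.pi by ring, Real.cos_add_pi,
      Real.cos_pi_div_two, neg_zero]
  have c21 : Real.cos (2 * Real.pi * 2 * 1 / 4) = -1 := by
    rw [← Real.cos_pi]; congr 1; ring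
  have c22 : Real.cos (2 * Real.pi * 2 * 2 / 4) = 1 := by
    rw [← Real.cos_two_pi]; congr 1; ring
  have c23 : Real.cos (2 * Real.pi * 2 * 3 / 4) = -1 := by
    rw [show 2 * Real.pi * 2 * 3 / 4 = Real.pi + 2 * Real.pi by ring, Real.cos_add_two_pi,
      Real.cos_pi]
  simp only [F, hω, hsum, Equiv.symm_apply_apply, v0, v1, v2, v3, Nat.cast_zero, Nat.cast_one,
    Nat.cast_ofNat, c11, c12, c13, c21, c22, c23, mul_zero, zero_mul, zero_div, Real.cos_zero]
  refine ⟨by ring, by ring, by ring⟩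

end FormClass

/-! ### From points of the diagonal forms to polygonal numbers -/

theorem exists_sign_dvd_add {p x q : ℤ} (hp : Prime p) (h : p ∣ x ^ 2 - q ^ 2) :
    ∃ x' k : ℤ, x' ^ 2 = x ^ 2 ∧ x' + q = p * k := by
  rw [sq_sub_sq] at h
  rcases hp.dvd_or_dvd h with ⟨k, hk⟩ | ⟨k, hk⟩
  · exact ⟨x, k, rfl, hk⟩
  · exact ⟨-x, -k, by ring, by linear_combination -hk⟩

section Parametrization

variable {p : ℤ} {n m : ℕ}

theorem exists_sq_add_iff_polygonal (hp : Prime p) (hodd : Odd p) (hm : (m : ℤ) = p + 2) (y : ℤ) :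
    (∃ x : ℤ, 1 * x ^ 2 + 2 * p * y ^ 2 = 2 * (m - 2) * (n : ℤ) ^ 2 + ((m : ℤ) - 4) ^ 2) ↔
      ∃ c : ℤ, (n : ℤ) ^ 2 - y ^ 2 = 4 * (1 : ℕ) * polygonal m c := by
  simp only [hm]
  have h4 : ∀ c, 4 * (1 : ℕ) * polygonal m c = 2 * (c * (p * c - (p - 2))) := fun c => by
    have h := two_mul_polygonal m c
    rw [hm] at h
    push_cast
    linear_combination 2 * h
  simp only [h4]
  constructor
  · rintro ⟨x, hx⟩
    obtain ⟨x', k, h1, h2⟩ := exists_sign_dvd_add (p := p) (x := x) (q := p - 2) hp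
      ⟨2 * (n ^ 2 - y ^ 2), by linear_combination hx⟩
    obtain ⟨r, rfl⟩ := hodd
    -- Both x' and p - 2 are odd, so pk = x' + p - 2 is even; with p odd, k = 2c.
    have hk : Even ((2 * r + 1) * k) := by
      rw [← h2]
      have h3 : Odd (x' ^ 2) := ⟨(2 * r + 1) * (n ^ 2 - y ^ 2) + 2 * r ^ 2 - 2 * r, by
        linear_combination h1 + hx⟩
      have h5 : Odd x' := Int.odd_pow.mp h3 |>.resolve_right two_ne_zero
      exact h5.add_odd ⟨r - 1, by ring⟩
    obtain ⟨c, rfl⟩ : 2 ∣ k := by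
      have := (Int.even_mul.mp hk).resolve_left (by simp)
      exact this.two_dvd
    refine ⟨c, mul_left_cancel₀ (mul_ne_zero two_ne_zero hp.ne_zero) ?_⟩
    have h3 : x' = (2 * r + 1) * (2 * c) - (2 * r + 1 - 2) := by linear_combination h2
    rw [← h1, h3] at hx
    linear_combination -hx
  · rintro ⟨c, hc⟩
    exact ⟨2 * p * c - (p - 2), by linear_combination (-2 * p) * hc⟩

theorem exists_two_sq_add_iff_polygonal (hp : Prime p) (hodd : Odd p) (hm : (m : ℤ) = 2 * p + 2)
    {z : ℤ} (hz : 2 * z = ((m : ℤ) - 2) * (n : ℤ) ^ 2 + ((m : ℤ) - 4) ^ 2) (y : ℤ) :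
    (∃ x : ℤ, 2 * x ^ 2 + p * y ^ 2 = z) ↔
      ∃ c : ℤ, (n : ℤ) ^ 2 - y ^ 2 = 4 * (2 : ℕ) * polygonal m c := by
  have hz' : z = p * n ^ 2 + 2 * (p - 1) ^ 2 := by
    rw [hm] at hz
    linarith
  have h4 : ∀ c, 4 * (2 : ℕ) * polygonal m c = 8 * (c * (p * c - (p - 1))) := fun c => by
    have h := two_mul_polygonal m c
    rw [hm] at h
    push_cast
    linear_combination 4 * h
  simp only [h4, hz']
  clear hz hz' h4
  constructor
  · rintro ⟨x, hx⟩
    have hdvd : p ∣ x ^ 2 - (p - 1) ^ 2 := by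
      refine IsCoprime.dvd_of_dvd_mul_left ?_
        (show p ∣ 2 * (x ^ 2 - (p - 1) ^ 2) from ⟨n ^ 2 - y ^ 2, by linear_combination hx⟩)
      obtain ⟨r, rfl⟩ := hodd
      exact ⟨1, -r, by ring⟩
    obtain ⟨x', k, h1, h2⟩ := exists_sign_dvd_add hp hdvd
    obtain ⟨r, rfl⟩ := hodd
    have h3 : 2 * x' ^ 2 = (2 * r + 1) * ((n - y) * (n + y)) + 8 * r ^ 2 := by
      rw [h1]
      linear_combination hx
    -- The two factors n - y and n + y have the same parity and their product is even; hence both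
    -- are even, and this in turn makes x' even.
    have hny : Even ((n : ℤ) - y) := by
      have h5 : Even ((2 * r + 1) * (((n : ℤ) - y) * (n + y))) :=
        ⟨x' ^ 2 - 4 * r ^ 2, by linear_combination -h3⟩
      have h6 := (Int.even_mul.mp h5).resolve_left (by simp)
      rcases Int.even_mul.mp h6 with h7 | h7
      · exact h7
      · rwa [Int.even_sub, ← Int.even_add]
    obtain ⟨s, hs⟩ := hny
    have hx' : Even x' := by
      have h5 : Even (x' ^ 2) := ⟨(2 * r + 1) * (s * (y + s)) + 2 * r ^ 2, by
        rw [eq_add_of_sub_eq hs] at h3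
        linarith⟩
      exact (Int.even_pow.mp h5).1
    have hk : Even ((2 * r + 1) * k) := by
      rw [← h2]
      exact hx'.add ⟨r, by ring⟩
    obtain ⟨c, rfl⟩ : 2 ∣ k := by
      have := (Int.even_mul.mp hk).resolve_left (by simp)
      exact this.two_dvd
    refine ⟨c, mul_left_cancel₀ hp.ne_zero ?_⟩
    have h5 : x' = (2 * r + 1) * (2 * c) - (2 * r + 1 - 1) := by linear_combination h2
    rw [h5] at h3
    linear_combination -h3
  · rintro ⟨c, hc⟩
    exact ⟨2 * p * c - (p - 1), by linear_combination (-p) * hc⟩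

end Parametrization

/-! ### The counting formulas and the five discriminants -/

namespace FormClass

theorem isFundamentalDiscriminant_of_isEvenDisc {d N : ℤ} (hd : IsEvenDisc d N) :
    IsFundamentalDiscriminant d := by
  refine .inr ⟨-N, by rw [hd.eq]; ring, .inl ?_, fun x hx => hd.sqf x ((dvd_neg).mp hx)⟩
  have := hd.mod
  omega

variable {d p : ℤ}

/-- The properties of `H(d)`, `d = -8 p`, on which the counting formulas rest. -/
structure IsCyclicOfPrime (d p : ℤ) : Prop where
  disc : IsEvenDisc d (2 * p)
  prime : Prime p
  two_lt : 2 < p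
  odd : Odd p
  iso : ∃ e : ZMod 4 ≃ FormClass d, IsGroupIso e ∧
    (∃ f : QForm d, e 0 = mk f ∧ f.a = 1 ∧ f.b = 0 ∧ f.c = 2 * p) ∧
    ∃ f : QForm d, e 2 = mk f ∧ f.a = 2 ∧ f.b = 0 ∧ f.c = p

theorem IsCyclicOfPrime.lt (h : IsCyclicOfPrime d p) : d < -4 := by
  have := h.disc.eq
  have := h.two_lt
  omega

theorem IsCyclicOfPrime.repCount_one (h : IsCyclicOfPrime d p) {m n : ℕ} (hm : (m : ℤ) = p + 2)
    (hn : 0 < n) {e : ZMod 4 ≃ FormClass d} (he : IsGroupIso e) {z : ℤ}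
    (hz : z = 2 * ((m : ℤ) - 2) * (n : ℤ) ^ 2 + ((m : ℤ) - 4) ^ 2) :
    (¬ IsSquare z → (repCount m 1 n : ℝ) =
      1 / 8 * (F e (e 0) z + 2 * F e (e 1) z + F e (e 2) z) - 1) ∧
    (IsSquare z → (repCount m 1 n : ℝ) =
      1 / 8 * (F e (e 0) z + 2 * F e (e 1) z + F e (e 2) z) - 1 / 2) := by
  obtain ⟨e', he', ⟨f, hf, ha, hb, hc⟩, -⟩ := h.iso
  obtain ⟨F0, F1, F2⟩ := F_values h.lt e z
  have hR := R_mk_of_diagonal f hb z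
  rw [← hf, ← (he.eq_zero_and_two he').1, ha, hc] at hR
  have h2 := h.two_lt
  -- A point with x = 0 would force p to divide (p-2)², hence 4.
  have hx : ∀ y : ℤ, 2 * p * y ^ 2 ≠ z := by
    intro y hy
    rw [hz, hm] at hy
    have h4 : p ∣ 2 ^ 2 := ⟨2 * y ^ 2 - 2 * n ^ 2 - p + 4, by linear_combination -hy⟩
    have := Int.le_of_dvd two_pos (h.prime.dvd_of_dvd_pow h4)
    omega
  have hkey := exists_sq_add_iff_polygonal (n := n) h.prime h.odd hm
  rw [← hz] at hkey
  obtain ⟨k1, k2⟩ := ncard_diagonal_eq_repCount (m := m) one_pos (by linarith) (by omega) one_pos hn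
    hx hkey
  have hsq : IsSquare z ↔ ∃ x : ℤ, 1 * x ^ 2 = z := by
    simp only [isSquare_iff_exists_sq, one_mul, eq_comm]
  rw [← hR, ← hsq] at k1 k2
  rw [F0, F1, F2]
  constructor
  · intro hs
    have := congrArg (Nat.cast (R := ℝ)) (k1 hs)
    push_cast at this
    linarith
  · intro hs
    have := congrArg (Nat.cast (R := ℝ)) (k2 hs)
    push_cast at this
    linarith

theorem IsCyclicOfPrime.repCount_two (h : IsCyclicOfPrime d p) {m n : ℕ}
    (hm : (m : ℤ) = 2 * p + 2) (hn : 0 < n) {e : ZMod 4 ≃ FormClass d} (he : IsGroupIso e) {z : ℤ}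
    (hz : 2 * z = ((m : ℤ) - 2) * (n : ℤ) ^ 2 + ((m : ℤ) - 4) ^ 2) :
    (¬ IsSquare (2 * z) → (repCount m 2 n : ℝ) =
      1 / 8 * (F e (e 0) z - 2 * F e (e 1) z + F e (e 2) z) - 1) ∧
    (IsSquare (2 * z) → (repCount m 2 n : ℝ) =
      1 / 8 * (F e (e 0) z - 2 * F e (e 1) z + F e (e 2) z) - 1 / 2) := by
  obtain ⟨e', he', -, f, hf, ha, hb, hc⟩ := h.iso
  obtain ⟨F0, F1, F2⟩ := F_values h.lt e z
  have hR := R_mk_of_diagonal f hb z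
  rw [← hf, ← (he.eq_zero_and_two he').2, ha, hc] at hR
  have h2 := h.two_lt
  -- A point with x = 0 would force p to divide 2(p-1)², hence 2.
  have hx : ∀ y : ℤ, p * y ^ 2 ≠ z := by
    intro y hy
    rw [hm, ← hy] at hz
    have h4 : p ∣ 2 := ⟨y ^ 2 - n ^ 2 - 2 * p + 4, by linarith⟩
    have := Int.le_of_dvd two_pos h4
    omega
  obtain ⟨k1, k2⟩ := ncard_diagonal_eq_repCount (m := m) two_pos (by linarith) (by omega) two_pos hn
    hx (exists_two_sq_add_iff_polygonal h.prime h.odd hm hz)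
  have hsq : IsSquare (2 * z) ↔ ∃ x : ℤ, 2 * x ^ 2 = z := by
    rw [isSquare_iff_exists_sq]
    constructor
    · rintro ⟨w, hw⟩
      have h5 : Even (w ^ 2) := ⟨z, by linarith⟩
      obtain ⟨x, rfl⟩ := (Int.even_pow.mp h5).1
      exact ⟨x, by linarith⟩
    · rintro ⟨x, rfl⟩
      exact ⟨2 * x, by ring⟩
  rw [← hR, ← hsq] at k1 k2
  rw [F0, F1, F2]
  constructor
  · intro hs
    have := congrArg (Nat.cast (R := ℝ)) (k1 hs)
    push_cast at this
    linarith
  · intro hs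
    have := congrArg (Nat.cast (R := ℝ)) (k2 hs)
    push_cast at this
    linarith

/-- Makes the search for reduced forms finite and decidable. From 4b² ≤ a'² and a'² ≤ a'c = b² + 2p
follows 3a'² ≤ 8p ≤ 576, so a' ≤ 13 and |b| ≤ 6; c is eliminated through a' ∣ b² + 2p. -/
theorem isCyclicOfPrime_of_reduced {a γ : ℤ} (hd : d = -8 * p) (hp : Prime p) (h2 : 2 < p)
    (hle : p ≤ 72) (ha : 0 < a) (h : a ^ 2 - 2 * γ ^ 2 = p)
    (hred : ∀ a' ∈ Finset.Icc (1 : ℤ) 13, ∀ b ∈ Finset.Icc (-6 : ℤ) 6, a' ∣ b ^ 2 + 2 * p →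
      2 * b ≤ a' → -(2 * b) ≤ a' → a' * a' ≤ b ^ 2 + 2 * p →
      (a' = 1 ∨ a' = 2 ∧ 2 ∣ b) ∨ a' = a ∧ (a ∣ b - 2 * γ ∨ a ∣ b + 2 * γ)) :
    IsCyclicOfPrime d p := by
  have hodd : Odd p := by
    by_contra hodd
    rw [Int.not_odd_iff_even] at hodd
    have h3 := (Int.prime_two.dvd_prime_iff_associated hp).mp hodd.two_dvd
    rw [Int.associated_iff] at h3
    omega
  have hdisc : IsEvenDisc d (2 * p) := by
    refine ⟨by linarith, by linarith, ?_, ?_⟩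
    · obtain ⟨r, rfl⟩ := hodd
      omega
    · rw [squarefree_mul_iff]
      refine ⟨?_, Int.prime_two.squarefree, hp.squarefree⟩
      obtain ⟨r, rfl⟩ := hodd
      exact IsCoprime.isRelPrime ⟨-r, 1, by ring⟩
  refine ⟨hdisc, hp, h2, hodd,
    exists_isGroupIso_of_reduced (γ := γ) hdisc ha (by linarith) (by rw [← h]; ring) ?_⟩
  intro a' b c hN hb hc
  have hpos : 0 ≤ a' := by linarith [abs_nonneg b]
  obtain ⟨hb1, hb2⟩ := abs_le.mp (show |b| ≤ a' / 2 by omega)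
  have hsq : 4 * b ^ 2 ≤ a' ^ 2 := by
    have := pow_le_pow_left₀ (by positivity) hb 2
    rwa [mul_pow, sq_abs] at this
  have hac := mul_le_mul_of_nonneg_left hc hpos
  have h13 : a' ≤ 13 := by
    by_contra h14
    nlinarith [show 14 ≤ a' by omega]
  have h1 : 1 ≤ a' := by
    rcases hpos.eq_or_lt with h0 | h0
    · rw [← h0, zero_mul] at hN
      nlinarith [sq_nonneg b]
    · exact h0
  refine hred a' (Finset.mem_Icc.mpr ⟨h1, h13⟩) b (Finset.mem_Icc.mpr ⟨by omega, by omega⟩)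
    ⟨c, by linear_combination -hN⟩ (by omega) (by omega) (by linarith)

theorem isCyclicOfPrime_seven : IsCyclicOfPrime (-56) 7 :=
  isCyclicOfPrime_of_reduced (a := 3) (γ := 1) (by norm_num)
    (Nat.prime_iff_prime_int.mp (by norm_num)) (by norm_num) (by norm_num) (by norm_num)
    (by norm_num) (by decide)

theorem isCyclicOfPrime_seventeen : IsCyclicOfPrime (-136) 17 :=
  isCyclicOfPrime_of_reduced (a := 5) (γ := 2) (by norm_num)
    (Nat.prime_iff_prime_int.mp (by norm_num)) (by norm_num) (by norm_num) (by norm_num)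
    (by norm_num) (by decide)

theorem isCyclicOfPrime_twenty_three : IsCyclicOfPrime (-184) 23 :=
  isCyclicOfPrime_of_reduced (a := 5) (γ := 1) (by norm_num)
    (Nat.prime_iff_prime_int.mp (by norm_num)) (by norm_num) (by norm_num) (by norm_num)
    (by norm_num) (by decide)

theorem isCyclicOfPrime_forty_one : IsCyclicOfPrime (-328) 41 :=
  isCyclicOfPrime_of_reduced (a := 7) (γ := 2) (by norm_num)
    (Nat.prime_iff_prime_int.mp (by norm_num)) (by norm_num) (by norm_num) (by norm_num)
    (by norm_num) (by decide)

theorem isCyclicOfPrime_seventy_one : IsCyclicOfPrime (-568) 71 :=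
  isCyclicOfPrime_of_reduced (a := 11) (γ := 5) (by norm_num)
    (Nat.prime_iff_prime_int.mp (by norm_num)) (by norm_num) (by norm_num) (by norm_num)
    (by norm_num) (by decide)

end FormClass

theorem theorem4 :
    (∀ (m : ℕ) (d : ℤ),
      (m, d) ∈ ({(9, -56), (19, -136), (25, -184), (43, -328), (73, -568)} : Set (ℕ × ℤ)) →
      d < 0 ∧ IsFundamentalDiscriminant d ∧
      (∃ e : ZMod 4 ≃ FormClass d, FormClass.IsGroupIso e) ∧
      ∀ e : ZMod 4 ≃ FormClass d, FormClass.IsGroupIso e →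
      ∀ I A A2 : FormClass d, I = e 0 → A = e 1 → A2 = e 2 →
      ∀ n : ℕ, 0 < n →
      ∀ z : ℤ, z = 2 * ((m : ℤ) - 2) * (n : ℤ) ^ 2 + ((m : ℤ) - 4) ^ 2 →
        (¬ IsSquare z → (repCount m 1 n : ℝ) =
          1 / 8 * (FormClass.F e I z + 2 * FormClass.F e A z + FormClass.F e A2 z) - 1) ∧
        (IsSquare z → (repCount m 1 n : ℝ) =
          1 / 8 * (FormClass.F e I z + 2 * FormClass.F e A z + FormClass.F e A2 z) - 1 / 2)) ∧
    (∀ (m : ℕ) (d : ℤ),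
      (m, d) ∈ ({(16, -56), (36, -136), (48, -184), (84, -328), (144, -568)} : Set (ℕ × ℤ)) →
      d < 0 ∧ IsFundamentalDiscriminant d ∧
      (∃ e : ZMod 4 ≃ FormClass d, FormClass.IsGroupIso e) ∧
      ∀ e : ZMod 4 ≃ FormClass d, FormClass.IsGroupIso e →
      ∀ I A A2 : FormClass d, I = e 0 → A = e 1 → A2 = e 2 →
      ∀ n : ℕ, 0 < n →
      ∀ z : ℤ, 2 * z = ((m : ℤ) - 2) * (n : ℤ) ^ 2 + ((m : ℤ) - 4) ^ 2 →
        (¬ IsSquare (2 * z) → (repCount m 2 n : ℝ) =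
          1 / 8 * (FormClass.F e I z - 2 * FormClass.F e A z + FormClass.F e A2 z) - 1) ∧
        (IsSquare (2 * z) → (repCount m 2 n : ℝ) =
          1 / 8 * (FormClass.F e I z - 2 * FormClass.F e A z + FormClass.F e A2 z) - 1 / 2)) := by
  constructor
  · intro m d hmd
    obtain ⟨p, h, hm⟩ : ∃ p : ℤ, FormClass.IsCyclicOfPrime d p ∧ (m : ℤ) = p + 2 := by
      simp only [Set.mem_insert_iff, Set.mem_singleton_iff, Prod.mk.injEq] at hmd
      rcases hmd with ⟨rfl, rfl⟩ | ⟨rfl, rfl⟩ | ⟨rfl, rfl⟩ | ⟨rfl, rfl⟩ | ⟨rfl, rfl⟩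
      · exact ⟨7, FormClass.isCyclicOfPrime_seven, rfl⟩
      · exact ⟨17, FormClass.isCyclicOfPrime_seventeen, rfl⟩
      · exact ⟨23, FormClass.isCyclicOfPrime_twenty_three, rfl⟩
      · exact ⟨41, FormClass.isCyclicOfPrime_forty_one, rfl⟩
      · exact ⟨71, FormClass.isCyclicOfPrime_seventy_one, rfl⟩
    refine ⟨by linarith [h.lt], FormClass.isFundamentalDiscriminant_of_isEvenDisc h.disc,
      h.iso.imp fun e he => he.1, ?_⟩
    rintro e he _ _ _ rfl rfl rfl n hn z hz
    exact h.repCount_one hm hn he hz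
  · intro m d hmd
    obtain ⟨p, h, hm⟩ : ∃ p : ℤ, FormClass.IsCyclicOfPrime d p ∧ (m : ℤ) = 2 * p + 2 := by
      simp only [Set.mem_insert_iff, Set.mem_singleton_iff, Prod.mk.injEq] at hmd
      rcases hmd with ⟨rfl, rfl⟩ | ⟨rfl, rfl⟩ | ⟨rfl, rfl⟩ | ⟨rfl, rfl⟩ | ⟨rfl, rfl⟩
      · exact ⟨7, FormClass.isCyclicOfPrime_seven, rfl⟩
      · exact ⟨17, FormClass.isCyclicOfPrime_seventeen, rfl⟩
      · exact ⟨23, FormClass.isCyclicOfPrime_twenty_three, rfl⟩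
      · exact ⟨41, FormClass.isCyclicOfPrime_forty_one, rfl⟩
      · exact ⟨71, FormClass.isCyclicOfPrime_seventy_one, rfl⟩
    refine ⟨by linarith [h.lt], FormClass.isFundamentalDiscriminant_of_isEvenDisc h.disc,
      h.iso.imp fun e he => he.1, ?_⟩
    rintro e he _ _ _ rfl rfl rfl n hn z hz
    exact h.repCount_two hm hn he hz
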